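/- **Setting.** An input of an online problem with binary predictions is a triple $(x,\hat x,r)$ with a finite request sequence $r=(r_1,\dots,r_n)$, true bits $x\in\{0,1\}^n$ and predicted bits $\hat x\in\{0,1\}^n$. A deterministic online algorithm answers request $r_i$ with a bit $y_i$ that depends only on $r_1,\hat x_1,\dots,r_i,\hat x_i$. Let $\mu_0(I)=\sum_i x_i(1-\hat x_i)$ and $\mu_1(I)=\sum_i(1-x_i)\hat x_i$. For constants $\alpha,\beta,\gamma\ge 0$, an algorithm is $(\alpha,\beta,\gamma)$-competitive (with respect to $(\mu_0,\mu_1)$) if there is $\kappa\in\mathbb R$ such that, for all instances $I$, $\mathrm{Opt}(I)\le\alpha\,\mathrm{Alg}(I)+\beta\mu_0(I)+\gamma\mu_1(I)+\kappa$ for a maximization problem, and $\mathrm{Alg}(I)\le\alpha\,\mathrm{Opt}(I)+\beta\mu_0(I)+\gamma\mu_1(I)+\kappa$ for a minimization problem. It is Pareto-optimal if none of the three parameters can be decreased (staying nonnegative) with the other two fixed, for any algorithm. A problem $Q$ is as hard as $P$ if, for all constants $\alpha,\beta,\gamma\ge 0$, the existence of a Pareto-optimal $(\alpha,\beta,\gamma)$-competitive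 algorithm for $Q$ implies the existence of an $(\alpha,\beta,\gamma)$-competitive algorithm for $P$. **Problems.** Let $t$ be a positive integer. In $\mathrm{ASG}_t$ every request is a mere prompt, every $x$ and $\hat x$ is allowed, and the cost $\sum_i\bigl(y_i+t\,x_i(1-y_i)\bigr)$ is to be minimized. In the following problems $y_i=0$ means that request $i$ is accepted; the profit, to be maximized, is the number of accepted requests if the accepted set is feasible and $-\infty$ otherwise; and in every instance the true bits $x$ encode an optimal solution. * $\mathrm{Sch}_t$: requests are nonempty intervals of $\mathbb R$, each of which overlaps (has nonempty intersection with) at most $t$ of the other requested intervals; feasible: no two accepted intervals overlap. * $\mathrm{SP}_t$: requests are finite subsets of a fixed infinite ground set, each of which intersects at most $t$ of the other requested sets; feasible: the accepted sets are pairwise disjoint. * $\mathrm{BDIS}_t$: the vertices of a graph of maximum degree at most $t$ arrive one by one, each with its edges to earlier vertices; feasible: the accepted vertices form an independent set. * $\mathrm{Cli}_t$: the vertices of a graph $G=(V,E)$ with $\delta(G)\ge |V|-1-t$ arrive one by one, each with its edges to earlier vertices; feasible: the accepted vertices form a clique. **Theorem.** For every positive integer $t$, each of the problems $\mathrm{Sch}_t$,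 $\mathrm{SP}_t$, $\mathrm{Cli}_t$ and $\mathrm{BDIS}_t$ is $\mathcal C^{t}_{\mu_0,\mu_1}$-complete, that is, $\mathrm{ASG}_t$ is as hard as the problem and the problem is as hard as $\mathrm{ASG}_t$, with respect to $(\mu_0,\mu_1)$. The same holds in the purely online setting, where algorithms receive no predictions, competitiveness is $c$-competitiveness for a constant $c\ge 0$ ($\mathrm{Opt}(I)\le c\,\mathrm{Alg}(I)+\kappa$, respectively $\mathrm{Alg}(I)\le c\,\mathrm{Opt}(I)+\kappa$), and $Q$ is as hard as $P$ if the existence of a $c$-competitive algorithm for $Q$ with $c$ smallest possible implies the existence of a $c$-competitive algorithm for $P$. -/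

import Mathlib

open scoped NNReal

universe u v

/-! ## Online problems with binary predictions -/

/-- One round of an input: the request `r_i`, the true bit `x_i` and the predicted bit.
An input `(x, x̂, r)` is a finite list of such rounds; the algorithm never sees `bit`. -/
structure Item (R : Type u) where
  request : R
  bit : Bool
  pred : Bool

/-- The true bits `x` of an input, read as a sequence of answers. -/
def trueBits {R : Type u} (I : List (Item R)) : Fin I.length → Bool :=
  fun i => I[i].bit

/-- The real number `0` or `1` represented by a bit. -/
def bitVal (b : Bool) : ℝ := if b then 1 else 0

inductive Goal
  | maximize
  | minimize

/-- An online problem with binary predictions. `value I y` is the profit (for a maximization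
problem) or the cost (for a minimization problem) of answering the requests of `I` by `y`. -/
structure OnlineProblem where
  Request : Type u
  goal : Goal
  IsInstance : List (Item Request) → Prop
  value : (I : List (Item Request)) → (Fin I.length → Bool) → EReal

namespace OnlineProblem

/-- The profit or cost of an optimal solution. -/
noncomputable def opt (P : OnlineProblem.{u}) (I : List (Item P.Request)) : EReal :=
  match P.goal with
  | Goal.maximize => ⨆ y, P.value I y
  | Goal.minimize => ⨅ y, P.value I y

/-- A deterministic online algorithm: the answer to the current request is a function of all
requests and predictions received so far, the current ones included. -/
abbrev Algorithm (P : OnlineProblem.{u}) : Type u := List (P.Request × Bool) → Bool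

/-- The answers `y` that an algorithm gives on the input `I`. -/
def answers {P : OnlineProblem.{u}} (A : P.Algorithm) (I : List (Item P.Request)) :
    Fin I.length → Bool :=
  fun i => A ((I.take (i + 1)).map fun s => (s.request, s.pred))

/-- The profit or cost of an algorithm on the input `I`. -/
def algValue (P : OnlineProblem.{u}) (A : P.Algorithm) (I : List (Item P.Request)) : EReal :=
  P.value I (answers A I)

end OnlineProblem

/-! ## Error measures -/

/-- An error measure: a finite nonnegative number computed from the sequence of pairs
`(x_i, x̂_i)`. -/
abbrev ErrorMeasure := List (Bool × Bool) → ℝ≥0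

/-- `μ₀ = ∑ x_i (1 - x̂_i)`, the number of wrong predictions `0`. -/
def mu0 : ErrorMeasure := fun L => (L.map fun p => if p.1 && !p.2 then (1 : ℝ≥0) else 0).sum

/-- `μ₁ = ∑ (1 - x_i) x̂_i`, the number of wrong predictions `1`. -/
def mu1 : ErrorMeasure := fun L => (L.map fun p => if !p.1 && p.2 then (1 : ℝ≥0) else 0).sum

/-- The error of an input. -/
def ErrorMeasure.on {R : Type u} (η : ErrorMeasure) (I : List (Item R)) : ℝ≥0 :=
  η (I.map fun s => (s.bit, s.pred))

/-! ## Competitiveness, hardness, and the complexity classes -/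

namespace OnlineProblem

/-- `A` is `(α, β, γ)`-competitive with respect to `(η₀, η₁)`. An infeasible solution of a
maximization problem has profit `⊥`. -/
def IsCompetitive (P : OnlineProblem.{u}) (η₀ η₁ : ErrorMeasure) (A : P.Algorithm)
    (α β γ : List (Item P.Request) → ℝ≥0) : Prop :=
  ∃ κ : ℝ, ∀ I, P.IsInstance I →
    match P.goal with
    | Goal.maximize => P.opt I ≤ ((α I : ℝ) : EReal) * P.algValue A I
        + ((β I * η₀.on I + γ I * η₁.on I + κ : ℝ) : EReal)
    | Goal.minimize => P.algValue A I ≤ ((α I : ℝ) : EReal) * P.opt I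
        + ((β I * η₀.on I + γ I * η₁.on I + κ : ℝ) : EReal)

/-- Some algorithm for `P` is `(α, β, γ)`-competitive, for constants `α, β, γ`. -/
def HasCompetitive (P : OnlineProblem.{u}) (η₀ η₁ : ErrorMeasure) (α β γ : ℝ≥0) : Prop :=
  ∃ A : P.Algorithm, P.IsCompetitive η₀ η₁ A (fun _ => α) (fun _ => β) (fun _ => γ)

/-- `A` is a Pareto-optimal `(α, β, γ)`-competitive algorithm: no algorithm is
`(α - ε, β, γ)`-, `(α, β - ε, γ)`- or `(α, β, γ - ε)`-competitive for any `ε > 0`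
(all parameters being nonnegative). -/
def IsParetoOptimal (P : OnlineProblem.{u}) (η₀ η₁ : ErrorMeasure) (A : P.Algorithm)
    (α β γ : ℝ≥0) : Prop :=
  P.IsCompetitive η₀ η₁ A (fun _ => α) (fun _ => β) (fun _ => γ) ∧
    (∀ α' < α, ¬ P.HasCompetitive η₀ η₁ α' β γ) ∧
    (∀ β' < β, ¬ P.HasCompetitive η₀ η₁ α β' γ) ∧
    (∀ γ' < γ, ¬ P.HasCompetitive η₀ η₁ α β γ')

/-- `Q` is (at least) as hard as `P` with respect to `(η₀, η₁)`. -/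
def AsHardAs (η₀ η₁ : ErrorMeasure) (Q : OnlineProblem.{u}) (P : OnlineProblem.{v}) : Prop :=
  ∀ α β γ : ℝ≥0, (∃ A : Q.Algorithm, Q.IsParetoOptimal η₀ η₁ A α β γ) →
    P.HasCompetitive η₀ η₁ α β γ

/-! ### The purely online setting: no predictions -/

/-- A deterministic online algorithm that receives no predictions. -/
abbrev PureAlgorithm (P : OnlineProblem.{u}) : Type u := List P.Request → Bool

/-- The answers of an algorithm without predictions. -/
def pureAnswers {P : OnlineProblem.{u}} (A : P.PureAlgorithm) (I : List (Item P.Request)) :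
    Fin I.length → Bool :=
  fun i => A ((I.take (i + 1)).map Item.request)

/-- `A` is `c`-competitive. -/
def IsPureCompetitive (P : OnlineProblem.{u}) (A : P.PureAlgorithm) (c : ℝ≥0) : Prop :=
  ∃ κ : ℝ, ∀ I, P.IsInstance I →
    match P.goal with
    | Goal.maximize => P.opt I ≤ ((c : ℝ) : EReal) * P.value I (pureAnswers A I) + (κ : EReal)
    | Goal.minimize => P.value I (pureAnswers A I) ≤ ((c : ℝ) : EReal) * P.opt I + (κ : EReal)

/-- `A` is a best possible `c`-competitive algorithm. -/
def IsPureOptimal (P : OnlineProblem.{u}) (A : P.PureAlgorithm) (c : ℝ≥0) : Prop :=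
  P.IsPureCompetitive A c ∧ ∀ c' < c, ¬ ∃ B : P.PureAlgorithm, P.IsPureCompetitive B c'

/-- `Q` is (at least) as hard as `P` in the purely online setting. -/
def PureAsHardAs (Q : OnlineProblem.{u}) (P : OnlineProblem.{v}) : Prop :=
  ∀ c : ℝ≥0, (∃ A : Q.PureAlgorithm, Q.IsPureOptimal A c) →
    ∃ B : P.PureAlgorithm, P.IsPureCompetitive B c

end OnlineProblem

/-- `(1,t)`-Asymmetric String Guessing with Unknown History and Predictions. A request is only a
prompt, and every bitstring is a possible true string. -/
noncomputable def ASG (t : ℕ) : OnlineProblem.{0} where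
  Request := Unit
  goal := Goal.minimize
  IsInstance := fun _ => True
  value := fun I y =>
    ((∑ i, (bitVal (y i) + t * bitVal (trueBits I i) * (1 - bitVal (y i))) : ℝ) : EReal)

namespace OnlineProblem

/-- `P` is a member of the class of `ASG t` with respect to `(η₀, η₁)`. -/
def InClass (t : ℕ) (η₀ η₁ : ErrorMeasure) (P : OnlineProblem.{u}) : Prop :=
  AsHardAs η₀ η₁ (ASG t) P

/-- `P` is hard for the class of `ASG t` with respect to `(η₀, η₁)`. -/
def IsHard (t : ℕ) (η₀ η₁ : ErrorMeasure) (P : OnlineProblem.{u}) : Prop :=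
  AsHardAs η₀ η₁ P (ASG t)

/-- `P` is complete for the class of `ASG t` with respect to `(η₀, η₁)`. -/
def IsComplete (t : ℕ) (η₀ η₁ : ErrorMeasure) (P : OnlineProblem.{u}) : Prop :=
  InClass t η₀ η₁ P ∧ IsHard t η₀ η₁ P

/-- `P` is complete for the class of `ASG t` in the purely online setting. -/
def IsPureComplete (t : ℕ) (P : OnlineProblem.{u}) : Prop :=
  PureAsHardAs (ASG t) P ∧ PureAsHardAs P (ASG t)

end OnlineProblem

/-! ## The maximization problems -/

/-- A selection problem: answering `0` accepts the request, the profit is the number of accepted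
requests if the set of accepted positions is feasible and `-∞` otherwise. In an instance the input
is admissible and the true bits encode an optimal solution. -/
noncomputable def selectionProblem (R : Type u) (admissible : List (Item R) → Prop)
    (feasible : (I : List (Item R)) → Set (Fin I.length) → Prop) : OnlineProblem.{u} :=
  let profit : (I : List (Item R)) → (Fin I.length → Bool) → EReal := fun I y =>
    open Classical in
    if feasible I {i | y i = false} then ((∑ i, (1 - bitVal (y i)) : ℝ) : EReal) else ⊥
  { Request := R
    goal := Goal.maximize
    IsInstance := fun I => admissible I ∧ ∀ y, profit I y ≤ profit I (trueBits I)
    value := profit }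

/-- In the vertex-arrival model the `i`-th request reveals the vertex `v_i` through the set of the
indices of its neighbours among the previously revealed vertices. -/
def IsVertexArrival (I : List (Item (Finset ℕ))) : Prop :=
  ∀ i : Fin I.length, ∀ j ∈ I[i].request, j < i

/-- The underlying graph of a vertex-arrival input. -/
def arrivalGraph (I : List (Item (Finset ℕ))) : SimpleGraph (Fin I.length) :=
  SimpleGraph.fromRel fun i j => (j : ℕ) ∈ I[i].request

open Classical in
/-- Online `t`-Bounded Degree Independent Set with Predictions: graphs of maximum degree at
most `t`. -/
noncomputable def BDIS (t : ℕ) : OnlineProblem.{0} :=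
  selectionProblem (Finset ℕ)
    (fun I => IsVertexArrival I ∧ (arrivalGraph I).maxDegree ≤ t)
    (fun I S => (arrivalGraph I).IsIndepSet S)

open Classical in
/-- Online `t`-Bounded Clique with Predictions: graphs of minimum degree at least `|V| - 1 - t`,
that is, every vertex has at most `t` non-neighbours other than itself. -/
noncomputable def Cli (t : ℕ) : OnlineProblem.{0} :=
  selectionProblem (Finset ℕ)
    (fun I => IsVertexArrival I ∧
      (I.length : ℤ) - 1 - (t : ℤ) ≤ ((arrivalGraph I).minDegree : ℤ))
    (fun I S => (arrivalGraph I).IsClique S)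

/-- Online `t`-Bounded Set-Arrival Set Packing with Predictions, for finite subsets of `U`: every
requested set intersects at most `t` other requested sets. -/
noncomputable def SP (U : Type u) (t : ℕ) : OnlineProblem.{u} :=
  selectionProblem (Finset U)
    (fun I => ∀ i : Fin I.length,
      {j : Fin I.length | j ≠ i ∧ ¬ Disjoint I[i].request I[j].request}.ncard ≤ t)
    (fun I S => S.PairwiseDisjoint fun i => I[i].request)

/-- A nonempty interval of the real line, of any kind. -/
abbrev RealInterval := {s : Set ℝ // s.Nonempty ∧ s.OrdConnected}

/-- Online `t`-Bounded Overlap Interval Scheduling with Predictions: every requested interval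
overlaps at most `t` other requested intervals. -/
noncomputable def Sch (t : ℕ) : OnlineProblem.{0} :=
  selectionProblem RealInterval
    (fun I => ∀ i : Fin I.length,
      {j : Fin I.length | j ≠ i ∧ (I[i].request.1 ∩ I[j].request.1).Nonempty}.ncard ≤ t)
    (fun I S => ∀ i ∈ S, ∀ j ∈ S, i ≠ j → ¬ (I[i].request.1 ∩ I[j].request.1).Nonempty)

/-! ## Counting -/

theorem card_filter_getElem {α : Type*} (L : List α) (p : α → Bool) :
    (Finset.univ.filter fun i : Fin L.length => p L[i] = true).card = L.countP p := by
  rw [Finset.card_filter]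
  have h := Fin.sum_univ_fun_getElem L (fun a => if p a = true then 1 else 0)
  simp only [Fin.getElem_fin]
  rw [h]
  clear h
  induction L with
  | nil => rfl
  | cons a L ih => rw [List.map_cons, List.sum_cons, ih, List.countP_cons, Nat.add_comm]

theorem mu0_on_eq_countP {R : Type u} (I : List (Item R)) :
    ((mu0.on I : ℝ≥0) : ℝ) = (I.countP fun s => s.bit && !s.pred : ℕ) := by
  unfold ErrorMeasure.on mu0
  induction I with
  | nil => simp
  | cons s I ih =>
    simp only [List.map_cons, List.sum_cons, NNReal.coe_add, ih, List.countP_cons]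
    split_ifs <;> simp [add_comm]

theorem mu1_on_eq_countP {R : Type u} (I : List (Item R)) :
    ((mu1.on I : ℝ≥0) : ℝ) = (I.countP fun s => !s.bit && s.pred : ℕ) := by
  unfold ErrorMeasure.on mu1
  induction I with
  | nil => simp
  | cons s I ih =>
    simp only [List.map_cons, List.sum_cons, NNReal.coe_add, ih, List.countP_cons]
    split_ifs <;> simp [add_comm]

/-! ## The region of achievable parameters -/

/-- The triples for which `ASG t` and the problems complete for its class admit a competitive
algorithm. -/
structure Achievable (t : ℕ) (α β γ : ℝ≥0) : Prop where
  one_le : (1 : ℝ) ≤ α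
  le_add : (t : ℝ) ≤ α + β
  le_or : (t : ℝ) ≤ α ∨ (1 : ℝ) ≤ γ

/-- If both alternatives failed, each of the `m` rounds would lose at least the smaller gap `δ`, so
`δ * m ≤ κ` for all `m`. The split of `m` into `a` and `r` is the algorithm's choice, hence the
disjunction. -/
theorem le_or_one_le_of_forall_rounds {t : ℕ} {A G κ : ℝ}
    (h : ∀ m : ℕ, ∃ a r : ℕ, a + r = m ∧ (r : ℝ) + t * a ≤ A * a + G * r + κ) :
    (t : ℝ) ≤ A ∨ 1 ≤ G := by
  by_contra! hc
  obtain ⟨hA, hG⟩ := hc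
  set δ := min ((t : ℝ) - A) (1 - G) with hδ
  have hδ0 : 0 < δ := lt_min (by linarith) (by linarith)
  obtain ⟨m, hm⟩ := exists_nat_gt (κ / δ)
  rw [div_lt_iff₀ hδ0] at hm
  obtain ⟨a, r, rfl, har⟩ := h m
  have h1 : δ * a ≤ (t - A) * a := mul_le_mul_of_nonneg_right (min_le_left _ _) a.cast_nonneg
  have h2 : δ * r ≤ (1 - G) * r := mul_le_mul_of_nonneg_right (min_le_right _ _) r.cast_nonneg
  push_cast at hm
  linarith

theorem one_le_of_forall_le_mul_add {A κ : ℝ} (h : ∀ m : ℕ, (m : ℝ) ≤ A * m + κ) : 1 ≤ A := by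
  by_contra! hA
  obtain ⟨m, hm⟩ := exists_nat_gt (κ / (1 - A))
  rw [div_lt_iff₀ (by linarith)] at hm
  linarith [h m]

/-! ## Asymmetric string guessing -/

namespace OnlineProblem

/-- An algorithm without predictions, as an algorithm that ignores them. -/
def PureAlgorithm.toAlgorithm {P : OnlineProblem.{u}} (A : P.PureAlgorithm) : P.Algorithm :=
  fun L => A (L.map Prod.fst)

theorem PureAlgorithm.answers_toAlgorithm {P : OnlineProblem.{u}} (A : P.PureAlgorithm)
    (I : List (Item P.Request)) : answers A.toAlgorithm I = pureAnswers A I := by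
  funext i
  simp only [answers, pureAnswers, PureAlgorithm.toAlgorithm, List.map_map]
  rfl

/-- This transfers the lower bounds with predictions to the purely online setting. -/
theorem IsPureCompetitive.hasCompetitive {P : OnlineProblem.{u}} {A : P.PureAlgorithm} {c : ℝ≥0}
    (h : P.IsPureCompetitive A c) (η₀ η₁ : ErrorMeasure) : P.HasCompetitive η₀ η₁ c 0 0 := by
  obtain ⟨κ, h⟩ := h
  refine ⟨A.toAlgorithm, κ, fun I hI => ?_⟩
  simpa [algValue, A.answers_toAlgorithm] using h I hI

end OnlineProblem

open OnlineProblem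

/-- The answers of an algorithm for a problem with requests in `R`. -/
def guesses {R : Type u} (A : List (R × Bool) → Bool) (I : List (Item R)) (i : Fin I.length) :
    Bool :=
  A ((I.take (i + 1)).map fun s => (s.request, s.pred))

namespace ASG

/-- The cost of one round of `ASG t`. -/
def roundCost (t : ℕ) (x y : Bool) : ℝ := bitVal y + t * bitVal x * (1 - bitVal y)

theorem bitVal_le_roundCost {t : ℕ} (ht : 0 < t) (x y : Bool) : bitVal x ≤ roundCost t x y := by
  have : (1 : ℝ) ≤ t := by exact_mod_cast ht
  cases x <;> cases y <;> simp [roundCost, bitVal, this]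

theorem countP_eq_sum {I : List (Item Unit)} (p : Item Unit → Bool) :
    ((I.countP p : ℕ) : ℝ) = ∑ i : Fin I.length, bitVal (p I[i]) := by
  rw [← card_filter_getElem I p, Finset.card_filter]
  push_cast
  exact Finset.sum_congr rfl fun i _ => rfl

/-- The true bits cost one per `1`, and since `t ≥ 1` no answer to a true bit `1` is cheaper. -/
theorem iInf_cost_eq {t : ℕ} (ht : 0 < t) (I : List (Item Unit)) :
    (⨅ y : Fin I.length → Bool, ((∑ i, roundCost t I[i].bit (y i) : ℝ) : EReal)) =
      (((I.countP (fun s => s.bit) : ℕ) : ℝ) : EReal) := by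
  rw [countP_eq_sum]
  apply le_antisymm
  · refine (iInf_le _ (trueBits I)).trans ?_
    rw [EReal.coe_le_coe_iff]
    refine Finset.sum_le_sum fun i _ => ?_
    simp only [trueBits]
    cases I[i].bit <;> simp [roundCost, bitVal]
  · refine le_iInf fun y => ?_
    rw [EReal.coe_le_coe_iff]
    exact Finset.sum_le_sum fun i _ => bitVal_le_roundCost ht _ _

theorem isCompetitive_iff {t : ℕ} (ht : 0 < t) (A : List (Unit × Bool) → Bool) (α β γ : ℝ≥0) :
    (ASG t).IsCompetitive mu0 mu1 A (fun _ => α) (fun _ => β) (fun _ => γ) ↔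
      ∃ κ : ℝ, ∀ I : List (Item Unit), ∑ i, roundCost t I[i].bit (guesses A I i) ≤
        α * (I.countP (fun s => s.bit) : ℕ) + (β * (I.countP fun s => s.bit && !s.pred : ℕ) +
          γ * (I.countP fun s => !s.bit && s.pred : ℕ) + κ) := by
  refine exists_congr fun κ => ?_
  change (∀ I : List (Item Unit), True →
    ((∑ i, roundCost t I[i].bit (guesses A I i) : ℝ) : EReal) ≤ ((α : ℝ) : EReal) *
      (⨅ y : Fin I.length → Bool, ((∑ i, roundCost t I[i].bit (y i) : ℝ) : EReal)) +
      ((β * mu0.on I + γ * mu1.on I + κ : ℝ) : EReal)) ↔ _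
  refine forall_congr' fun I => ?_
  rw [iInf_cost_eq ht, mu0_on_eq_countP, mu1_on_eq_countP, ← EReal.coe_mul, ← EReal.coe_add,
    EReal.coe_le_coe_iff, forall_const]

theorem sum_roundCost_zero (t : ℕ) (I : List (Item Unit)) :
    ∑ i : Fin I.length, roundCost t I[i].bit false = t * (I.countP (fun s => s.bit) : ℕ) := by
  rw [countP_eq_sum, Finset.mul_sum]
  exact Finset.sum_congr rfl fun i _ => by simp [roundCost, bitVal]

/-- The algorithm that answers each request by its predicted bit. -/
def followPrediction (L : List (Unit × Bool)) : Bool := (L.getLast?.map Prod.snd).getD false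

theorem guesses_followPrediction (I : List (Item Unit)) (i : Fin I.length) :
    guesses followPrediction I i = I[i].pred := by
  simp [guesses, followPrediction, List.getLast?_take]

theorem hasCompetitive {t : ℕ} (ht : 0 < t) {α β γ : ℝ≥0} (h : Achievable t α β γ) :
    (ASG t).HasCompetitive mu0 mu1 α β γ := by
  by_cases hα : (t : ℝ) ≤ α
  · refine ⟨fun _ => false, (isCompetitive_iff ht _ _ _ _).2 ⟨0, fun I => ?_⟩⟩
    refine (sum_roundCost_zero t I).le.trans ?_
    have : (0 : ℝ) ≤ β * (I.countP fun s => s.bit && !s.pred : ℕ) +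
        γ * (I.countP fun s => !s.bit && s.pred : ℕ) + 0 := by positivity
    have := mul_le_mul_of_nonneg_right hα ((I.countP (fun s => s.bit)).cast_nonneg (α := ℝ))
    linarith
  · have hγ := h.le_or.resolve_left hα
    have h1 := h.one_le
    have h2 := h.le_add
    push Not at hα
    refine ⟨followPrediction,
      (isCompetitive_iff ht _ _ _ _).2 ⟨0, fun I => ?_⟩⟩
    rw [countP_eq_sum, countP_eq_sum, countP_eq_sum, add_zero, Finset.mul_sum, Finset.mul_sum,
      Finset.mul_sum, ← Finset.sum_add_distrib, ← Finset.sum_add_distrib]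
    refine Finset.sum_le_sum fun i _ => ?_
    rw [guesses_followPrediction]
    -- For the pair (true bit, prediction): `(1,1)` costs `1 ≤ α`, `(1,0)` costs `t ≤ α + β`,
    -- `(0,1)` costs `1 ≤ γ`, and `(0,0)` is free.
    cases I[i].bit <;> cases I[i].pred <;> simp [roundCost, bitVal] <;> linarith

/-- The adversary that sets every true bit to the opposite of the answer. -/
def adversary (D : List (Unit × Bool) → Bool) (b : Bool) : ℕ → List (Item Unit)
  | 0 => []
  | m + 1 => adversary D b m ++
      [⟨(), !D ((adversary D b m).map (fun s => (s.request, s.pred)) ++ [((), b)]), b⟩]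

theorem length_adversary (D : List (Unit × Bool) → Bool) (b : Bool) (m : ℕ) :
    (adversary D b m).length = m := by
  induction m with
  | zero => rfl
  | succ m ih => simp [adversary, ih]

/-- Later rounds leave the prefix up to `i` unchanged, so the answer anticipated when round `i` was
created is the one given on the whole input. -/
theorem bit_adversary (D : List (Unit × Bool) → Bool) (b : Bool) (m i : ℕ)
    (hi : i < (adversary D b m).length) : (adversary D b m)[i].bit =
      !D (((adversary D b m).take (i + 1)).map fun s => (s.request, s.pred)) := by
  induction m with
  | zero => simp [adversary] at hi
  | succ m ih =>
    simp only [adversary]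
    rcases Nat.lt_or_ge i (adversary D b m).length with h | h
    · rw [List.getElem_append_left h, ih h, List.take_append_of_le_length h]
    · have : i = (adversary D b m).length := by
        simp [adversary] at hi; omega
      subst this
      rw [List.getElem_append_right le_rfl, List.take_of_length_le (by simp)]
      simp

theorem pred_adversary (D : List (Unit × Bool) → Bool) (b : Bool) (m : ℕ) :
    ∀ s ∈ adversary D b m, s.pred = b := by
  induction m with
  | zero => simp [adversary]
  | succ m ih =>
    intro s hs
    simp only [adversary, List.mem_append, List.mem_singleton] at hs
    rcases hs with hs | rfl
    · exact ih s hs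
    · rfl

theorem achievable {t : ℕ} (ht : 0 < t) {α β γ : ℝ≥0}
    (h : (ASG t).HasCompetitive mu0 mu1 α β γ) : Achievable t α β γ := by
  obtain ⟨A, hA⟩ := h
  change List (Unit × Bool) → Bool at A
  obtain ⟨κ, h⟩ := (isCompetitive_iff ht _ _ _ _).1 hA
  -- Every answer is wrong: a true bit `0` costs `1` and a true bit `1` costs `t`.
  have cost : ∀ b m, ∑ i, roundCost t (adversary A b m)[i].bit (guesses A _ i) =
      ((adversary A b m).countP (fun s => !s.bit) : ℕ) +
        t * ((adversary A b m).countP (fun s => s.bit) : ℕ) := by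
    intro b m
    rw [countP_eq_sum, countP_eq_sum, Finset.mul_sum, ← Finset.sum_add_distrib]
    refine Finset.sum_congr rfl fun i _ => ?_
    have hb := bit_adversary A b m i i.2
    have hb' : guesses A (adversary A b m) i = !(adversary A b m)[i].bit := by
      rw [Fin.getElem_fin, hb, Bool.not_not]; rfl
    rw [hb']
    cases (adversary A b m)[i].bit <;> simp [roundCost, bitVal]
  have len : ∀ b m, (adversary A b m).countP (fun s => s.bit) +
      (adversary A b m).countP (fun s => !s.bit) = m := by
    intro b m
    have := List.length_eq_countP_add_countP (fun s : Item Unit => s.bit) (l := adversary A b m)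
    rw [length_adversary] at this
    simpa using this.symm
  have e0 : ∀ b m, (adversary A b m).countP (fun s => s.bit && !s.pred) =
      if b then 0 else (adversary A b m).countP (fun s => s.bit) := by
    intro b m
    cases b
    · exact List.countP_congr fun s hs => by simp [pred_adversary A _ m s hs]
    · exact List.countP_eq_zero.2 fun s hs => by simp [pred_adversary A _ m s hs]
  have e1 : ∀ b m, (adversary A b m).countP (fun s => !s.bit && s.pred) =
      if b then (adversary A b m).countP (fun s => !s.bit) else 0 := by
    intro b m
    cases b
    · exact List.countP_eq_zero.2 fun s hs => by simp [pred_adversary A _ m s hs]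
    · exact List.countP_congr fun s hs => by simp [pred_adversary A _ m s hs]
  refine ⟨?_, ?_, ?_⟩
  -- Correctly predicted ones: no error, optimum `m`, and every algorithm pays at least `m`.
  · refine one_le_of_forall_le_mul_add (κ := κ) fun m => ?_
    have := h (List.replicate m ⟨(), true, true⟩)
    simp only [List.countP_replicate, Bool.not_true, Bool.and_false, Bool.false_and] at this
    refine le_trans ?_ (this.trans (by simp))
    calc (m : ℝ) = ∑ i : Fin (List.replicate m (⟨(), true, true⟩ : Item Unit)).length, 1 := by simp
      _ ≤ _ := by
        refine Finset.sum_le_sum fun i _ => ?_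
        have hb : (List.replicate m (⟨(), true, true⟩ : Item Unit))[i].bit = true := by simp
        rw [hb]
        exact bitVal_le_roundCost ht true _
  -- With all predictions `0` there is no `μ₁` error, so `G = 0` and the second alternative is
  -- impossible.
  · refine (le_or_one_le_of_forall_rounds (G := 0) (κ := κ)
      fun m => ⟨_, _, len false m, ?_⟩).resolve_right (by norm_num)
    have := h (adversary A false m)
    rw [cost, e0, e1] at this
    simp only [Bool.false_eq_true, if_false, Nat.cast_zero] at this
    linarith
  · refine le_or_one_le_of_forall_rounds (κ := κ) fun m => ⟨_, _, len true m, ?_⟩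
    have := h (adversary A true m)
    rw [cost, e0, e1] at this
    simp only [if_true, Nat.cast_zero] at this
    linarith

theorem exists_isPureCompetitive {t : ℕ} (ht : 0 < t) {c : ℝ≥0} (h : (t : ℝ) ≤ c) :
    ∃ B : (ASG t).PureAlgorithm, (ASG t).IsPureCompetitive B c := by
  have key : ∀ I : List (Item Unit),
      ((∑ i : Fin I.length, roundCost t I[i].bit false : ℝ) : EReal) ≤
        ((c : ℝ) : EReal) * (⨅ y : Fin I.length → Bool,
          ((∑ i, roundCost t I[i].bit (y i) : ℝ) : EReal)) + ((0 : ℝ) : EReal) := by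
    intro I
    rw [iInf_cost_eq ht, sum_roundCost_zero, ← EReal.coe_mul, ← EReal.coe_add,
      EReal.coe_le_coe_iff, add_zero]
    exact mul_le_mul_of_nonneg_right h (Nat.cast_nonneg _)
  exact ⟨fun _ => false, 0, fun I _ => key I⟩

end ASG

/-! ## Selection problems given by pairwise conflicts -/

/-- Positions `i` and `j` of the input are in conflict; `conf p r r'` says that the request `r` at
position `p` is in conflict with the later request `r'`. -/
def ConflictAt {R : Type u} (conf : ℕ → R → R → Prop) (I : List (Item R)) (i j : Fin I.length) :
    Prop :=
  (i < j ∧ conf i I[i].request I[j].request) ∨ (j < i ∧ conf j I[j].request I[i].request)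

theorem ConflictAt.symm {R : Type u} {conf : ℕ → R → R → Prop} {I : List (Item R)}
    {i j : Fin I.length} (h : ConflictAt conf I i j) : ConflictAt conf I j i :=
  Or.symm h

/-- The admissible inputs are those with valid requests, each of which is in conflict with at most
`t` others, and the feasible sets are those without conflicts. -/
structure IsConflictProblem {R : Type u} (t : ℕ) (valid : ℕ → R → Prop)
    (conf : ℕ → R → R → Prop) (admissible : List (Item R) → Prop)
    (feasible : (I : List (Item R)) → Set (Fin I.length) → Prop) : Prop where
  admissible_iff : ∀ I, admissible I ↔ (∀ i : Fin I.length, valid i I[i].request) ∧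
    ∀ i, {j | ConflictAt conf I i j}.ncard ≤ t
  feasible_iff : ∀ I, (∀ i : Fin I.length, valid i I[i].request) → ∀ S,
    feasible I S ↔ ∀ i ∈ S, ∀ j ∈ S, ¬ ConflictAt conf I i j

section Profit

variable {R : Type u} (admissible : List (Item R) → Prop)
  (feasible : (I : List (Item R)) → Set (Fin I.length) → Prop)

open Classical in
/-- The profit in a selection problem. -/
noncomputable def profit (I : List (Item R)) (y : Fin I.length → Bool) : EReal :=
  if feasible I {i | y i = false} then ((∑ i, (1 - bitVal (y i)) : ℝ) : EReal) else ⊥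

/-- The admissible inputs whose true bits encode an optimal solution. -/
def IsSelectionInstance (I : List (Item R)) : Prop :=
  admissible I ∧ ∀ y, profit feasible I y ≤ profit feasible I (trueBits I)

variable {admissible feasible}

theorem profit_of_feasible {I : List (Item R)} {y : Fin I.length → Bool}
    (h : feasible I {i | y i = false}) : profit feasible I y =
      (((Finset.univ.filter fun i => y i = false).card : ℝ) : EReal) := by
  simp only [profit, if_pos h, Finset.card_filter]
  congr 1
  push_cast
  refine Finset.sum_congr rfl fun i _ => ?_
  cases y i <;> simp [bitVal]

theorem profit_of_not_feasible {I : List (Item R)} {y : Fin I.length → Bool}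
    (h : ¬ feasible I {i | y i = false}) : profit feasible I y = ⊥ :=
  if_neg h

theorem card_trueBits (I : List (Item R)) :
    (Finset.univ.filter fun i => trueBits I i = false).card = I.countP fun s => !s.bit := by
  rw [← card_filter_getElem I fun s => !s.bit]
  congr 1
  ext i
  simp only [Finset.mem_filter, Finset.mem_univ, true_and, Bool.not_eq_true']
  rfl

/-- Rejecting everything has a finite profit, so an optimal solution cannot have profit `⊥`. -/
theorem IsSelectionInstance.feasible_trueBits {I : List (Item R)} (h0 : feasible I ∅)
    (hI : IsSelectionInstance admissible feasible I) : feasible I {i | trueBits I i = false} := by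
  by_contra h
  have h1 := hI.2 fun _ => true
  rw [profit_of_not_feasible h, profit_of_feasible (by simpa using h0), le_bot_iff] at h1
  exact EReal.coe_ne_bot _ h1

theorem IsSelectionInstance.iSup_profit {I : List (Item R)} (h0 : feasible I ∅)
    (hI : IsSelectionInstance admissible feasible I) :
    ⨆ y, profit feasible I y = (((I.countP fun s => !s.bit : ℕ) : ℝ) : EReal) := by
  rw [← card_trueBits, ← profit_of_feasible (hI.feasible_trueBits h0)]
  exact le_antisymm (iSup_le hI.2) (le_iSup _ (trueBits I))

theorem selectionProblem_isCompetitive_iff (A : List (R × Bool) → Bool) (α β γ : ℝ≥0) :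
    (selectionProblem R admissible feasible).IsCompetitive mu0 mu1 A
      (fun _ => α) (fun _ => β) (fun _ => γ) ↔
      ∃ κ : ℝ, ∀ I : List (Item R), IsSelectionInstance admissible feasible I →
        ⨆ y, profit feasible I y ≤ ((α : ℝ) : EReal) * profit feasible I (guesses A I) +
          ((β * mu0.on I + γ * mu1.on I + κ : ℝ) : EReal) :=
  Iff.rfl

theorem selectionProblem_isPureCompetitive_iff (A : List R → Bool) (c : ℝ≥0) :
    (selectionProblem R admissible feasible).IsPureCompetitive A c ↔
      ∃ κ : ℝ, ∀ I : List (Item R), IsSelectionInstance admissible feasible I →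
        ⨆ y, profit feasible I y ≤ ((c : ℝ) : EReal) *
          profit feasible I (fun i => A ((I.take (i + 1)).map Item.request)) + (κ : EReal) :=
  Iff.rfl

end Profit

/-! ### Greedy algorithms -/

/-- Accept (answer `false`) every request that the algorithm is willing to accept and that is not
in conflict with an earlier accepted one. -/
noncomputable def greedy {X : Type v} {R : Type u} (req : X → R) (willing : X → Prop)
    (conf : ℕ → R → R → Prop) (L : List X) : Bool :=
  open Classical in
  !decide (∃ h : L ≠ [], willing (L.getLast h) ∧ ∀ (j : ℕ) (hj : j + 1 < L.length),
    greedy req willing conf (L.take (j + 1)) = false → ¬ conf j (req L[j]) (req (L.getLast h)))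
termination_by L.length
decreasing_by
  all_goals rw [List.length_take]
  all_goals omega

/-- The recursion looks only at shorter prefixes of the same list, so along one input it becomes a
condition on positions. The observation type `X` is kept general to cover requests with and without
predictions. -/
theorem greedy_take {X : Type v} {R : Type u} (req : X → R) (willing : X → Prop)
    (conf : ℕ → R → R → Prop) (L : List X) (i : ℕ) (hi : i < L.length) :
    greedy req willing conf (L.take (i + 1)) = false ↔ willing L[i] ∧
      ∀ (j : ℕ) (hj : j < i), greedy req willing conf (L.take (j + 1)) = false →
        ¬ conf j (req L[j]) (req L[i]) := by
  have hne : L.take (i + 1) ≠ [] :=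
    List.ne_nil_of_length_pos (by rw [List.length_take]; omega)
  have hlast : (L.take (i + 1)).getLast hne = L[i] := by
    rw [List.getLast_eq_getElem, List.getElem_take]
    exact getElem_congr_idx (by rw [List.length_take]; omega)
  have hlen : (L.take (i + 1)).length = i + 1 := by simp; omega
  rw [greedy]
  simp only [Bool.not_eq_false', decide_eq_true_eq, exists_prop_of_true hne, hlast, hlen]
  refine and_congr_right fun _ => forall_congr' fun j => ⟨fun h hj => ?_, fun h hj => ?_⟩
  · have := h (by omega)
    rwa [List.take_take, Nat.min_eq_left (by omega), List.getElem_take] at this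
  · have := h (by omega)
    rwa [List.take_take, Nat.min_eq_left (by omega), List.getElem_take]

/-- Answers that accept greedily among the willing positions. -/
def IsGreedy {R : Type u} (conf : ℕ → R → R → Prop) (I : List (Item R))
    (willing : Fin I.length → Prop) (y : Fin I.length → Bool) : Prop :=
  ∀ i, y i = false ↔ willing i ∧ ∀ j < i, y j = false → ¬ conf j I[j].request I[i].request

theorem isGreedy_greedy {X : Type v} {R : Type u} (obs : Item R → X) (req : X → R)
    (hreq : ∀ s, req (obs s) = s.request) (willing : X → Prop) (conf : ℕ → R → R → Prop)
    (I : List (Item R)) : IsGreedy conf I (fun i => willing (obs I[i]))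
      fun i => greedy req willing conf ((I.take (i + 1)).map obs) := by
  intro i
  have := greedy_take req willing conf (I.map obs) i (by simp)
  simp only [List.map_take, this, List.getElem_map, hreq, Fin.getElem_fin]
  refine and_congr_right fun _ => ⟨fun h j hj => h j hj, fun h j hj => h ⟨j, by omega⟩ hj⟩

section Counting

variable {R : Type u} {conf : ℕ → R → R → Prop} {I : List (Item R)}
  {willing : Fin I.length → Prop} {y : Fin I.length → Bool}

theorem IsGreedy.not_conflictAt (h : IsGreedy conf I willing y) {i j : Fin I.length}
    (hi : y i = false) (hj : y j = false) : ¬ ConflictAt conf I i j := by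
  rintro (⟨hlt, hc⟩ | ⟨hlt, hc⟩)
  · exact ((h j).1 hj).2 i hlt hi hc
  · exact ((h i).1 hi).2 j hlt hj hc

open Classical in
/-- A greedy solution against a conflict-free set `O`: outside `O` every accepted request spoils
at most `t` requests of `O`. -/
theorem IsGreedy.card_le (h : IsGreedy conf I willing y) {t : ℕ}
    (hdeg : ∀ i, {j | ConflictAt conf I i j}.ncard ≤ t) (O : Finset (Fin I.length))
    (hO : ∀ i ∈ O, ∀ j ∈ O, ¬ ConflictAt conf I i j) :
    (O.filter willing).card ≤ (Finset.univ.filter fun i => y i = false ∧ i ∈ O).card +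
      t * (Finset.univ.filter fun i => y i = false ∧ i ∉ O).card := by
  set T := Finset.univ.filter fun i => y i = false ∧ i ∉ O
  -- A willing but rejected member of `O` is charged to an earlier accepted request in conflict with
  -- it, which lies outside `O` because `O` is conflict-free.
  have hsub : O.filter willing ⊆ (Finset.univ.filter fun i => y i = false ∧ i ∈ O) ∪
      T.biUnion fun i => Finset.univ.filter fun j => ConflictAt conf I i j := by
    intro i hi
    rw [Finset.mem_filter] at hi
    by_cases hy : y i = false
    · simp [hy, hi.1]
    · have : ¬ ∀ j < i, y j = false → ¬ conf j I[j].request I[i].request :=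
        fun hall => hy ((h i).2 ⟨hi.2, hall⟩)
      push Not at this
      obtain ⟨j, hj, hyj, hc⟩ := this
      have hji : ConflictAt conf I j i := Or.inl ⟨hj, hc⟩
      refine Finset.mem_union_right _ (Finset.mem_biUnion.2 ⟨j, ?_, by simpa using hji⟩)
      simp only [T, Finset.mem_filter, Finset.mem_univ, true_and]
      exact ⟨hyj, fun hjO => hO j hjO i hi.1 hji⟩
  refine (Finset.card_le_card hsub).trans ((Finset.card_union_le _ _).trans ?_)
  refine Nat.add_le_add_left ?_ _
  rw [mul_comm]
  refine Finset.card_biUnion_le_card_mul _ _ _ fun i _ => ?_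
  refine le_trans (le_of_eq ?_) (hdeg i)
  rw [Set.ncard_eq_toFinset_card']
  congr 1
  ext j
  simp

end Counting

/-! ### Upper bounds for conflict problems -/

namespace IsConflictProblem

variable {R : Type u} {t : ℕ} {valid : ℕ → R → Prop} {conf : ℕ → R → R → Prop}
  {admissible : List (Item R) → Prop} {feasible : (I : List (Item R)) → Set (Fin I.length) → Prop}

section Instance

variable (hP : IsConflictProblem t valid conf admissible feasible) {I : List (Item R)}

include hP

theorem feasible_empty (hI : admissible I) : feasible I ∅ := by
  rw [hP.feasible_iff I ((hP.admissible_iff I).1 hI).1]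
  simp

variable (hI : IsSelectionInstance admissible feasible I)

include hI

theorem profit_eq_of_isGreedy {willing : Fin I.length → Prop} {y : Fin I.length → Bool}
    (hy : IsGreedy conf I willing y) : profit feasible I y =
      (((Finset.univ.filter fun i => y i = false).card : ℝ) : EReal) := by
  rw [profit_of_feasible]
  rw [hP.feasible_iff I ((hP.admissible_iff I).1 hI.1).1]
  exact fun i hi j hj => hy.not_conflictAt hi hj

/-- Here `p` and `q` count the accepted requests inside and outside the optimum encoded by the true
bits. The last summand accounts for optimal requests that the algorithm is unwilling to accept. -/
theorem exists_split_of_isGreedy {willing : Item R → Bool} {y : Fin I.length → Bool}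
    (hy : IsGreedy conf I (fun i => willing I[i] = true) y) :
    ∃ p q : ℕ, (Finset.univ.filter fun i => y i = false).card = p + q ∧
      q ≤ I.countP (fun s => willing s && s.bit) ∧
      I.countP (fun s => !s.bit) ≤ p + t * q + I.countP fun s => !willing s && !s.bit := by
  have hv := (hP.admissible_iff I).1 hI.1
  have hx := hI.feasible_trueBits (hP.feasible_empty hI.1)
  rw [hP.feasible_iff I hv.1] at hx
  classical
  set O := Finset.univ.filter fun i => trueBits I i = false with hOdef
  have hcard := hy.card_le hv.2 O (by simpa [hOdef] using hx)
  refine ⟨(Finset.univ.filter fun i => y i = false ∧ i ∈ O).card,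
    (Finset.univ.filter fun i => y i = false ∧ i ∉ O).card, ?_, ?_, ?_⟩
  · rw [← Finset.card_filter_add_card_filter_not (· ∈ O), Finset.filter_filter,
      Finset.filter_filter]
  · rw [← card_filter_getElem]
    refine Finset.card_le_card fun i => ?_
    simp only [hOdef, Finset.mem_filter, Finset.mem_univ, true_and, Bool.and_eq_true,
      Bool.not_eq_false]
    exact fun h => ⟨((hy i).1 h.1).1, h.2⟩
  · rw [← card_trueBits, ← hOdef,
      ← Finset.card_filter_add_card_filter_not (fun i => willing I[i] = true) (s := O)]
    refine add_le_add (le_trans (le_of_eq (by congr)) hcard) ?_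
    rw [← card_filter_getElem]
    refine Finset.card_le_card fun i => ?_
    simp only [hOdef, Finset.mem_filter, Finset.mem_univ, true_and, Bool.and_eq_true,
      Bool.not_eq_true', Bool.not_eq_true]
    exact fun h => ⟨h.2, h.1⟩

end Instance

/-- If all requests are welcome, the optimum is at most `p + t q ≤ t (p + q)`, as `t ≥ 1`. -/
theorem exists_isPureCompetitive (hP : IsConflictProblem t valid conf admissible feasible)
    (ht : 0 < t) {c : ℝ≥0} (hc : (t : ℝ) ≤ c) :
    ∃ B : (selectionProblem R admissible feasible).PureAlgorithm,
      (selectionProblem R admissible feasible).IsPureCompetitive B c := by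
  refine ⟨greedy (X := R) id (fun _ => true = true) conf,
    (selectionProblem_isPureCompetitive_iff _ _).2 ⟨0, fun I hI => ?_⟩⟩
  have hy := isGreedy_greedy Item.request id (fun _ => rfl) (fun _ => true = true) conf I
  obtain ⟨p, q, h1, -, h3⟩ := hP.exists_split_of_isGreedy hI (willing := fun _ => true) hy
  rw [hI.iSup_profit (hP.feasible_empty hI.1)]
  refine le_trans ?_ (add_le_add_left (mul_le_mul_of_nonneg_left
    (hP.profit_eq_of_isGreedy hI hy).ge (EReal.coe_nonneg.2 c.coe_nonneg)) _)
  rw [h1, ← EReal.coe_mul, ← EReal.coe_add, EReal.coe_le_coe_iff, add_zero]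
  have h4 : I.countP (fun s => !s.bit) ≤ t * (p + q) := by
    have hp : p ≤ t * p := Nat.le_mul_of_pos_left p ht
    simp only [Bool.not_true, Bool.false_and, List.countP_false, Function.const_apply,
      add_zero] at h3
    linarith
  calc _ ≤ ((t * (p + q) : ℕ) : ℝ) := by exact_mod_cast h4
    _ ≤ _ := by
      rw [Nat.cast_mul]
      exact mul_le_mul_of_nonneg_right hc (Nat.cast_nonneg _)

theorem hasCompetitive (hP : IsConflictProblem t valid conf admissible feasible)
    (ht : 0 < t) {α β γ : ℝ≥0} (h : Achievable t α β γ) :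
    (selectionProblem R admissible feasible).HasCompetitive mu0 mu1 α β γ := by
  by_cases hα : (t : ℝ) ≤ α
  · obtain ⟨B, hB⟩ := hP.exists_isPureCompetitive ht hα
    obtain ⟨A, κ, hA⟩ := hB.hasCompetitive mu0 mu1
    refine ⟨A, κ, fun I hI => (hA I hI).trans (add_le_add le_rfl ?_)⟩
    rw [EReal.coe_le_coe_iff]
    have : (0 : ℝ) ≤ β * mu0.on I + γ * mu1.on I := by positivity
    simp only [NNReal.coe_zero, zero_mul, zero_add]
    linarith
  have hγ := h.le_or.resolve_left hα
  -- Only requests predicted `0` are welcome. So each of the `q` accepted requests outside the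
  -- optimum is a `μ₀` error, and each unwelcome optimal request is a `μ₁` error.
  refine ⟨greedy (X := R × Bool) Prod.fst (fun s => (!s.2) = true) conf,
    (selectionProblem_isCompetitive_iff _ _ _ _).2 ⟨0, fun I hI => ?_⟩⟩
  have hy := isGreedy_greedy (fun s => (s.request, s.pred)) Prod.fst (fun _ => rfl)
    (fun s => (!s.2) = true) conf I
  obtain ⟨p, q, h1, h2, h3⟩ := hP.exists_split_of_isGreedy hI (willing := fun s => !s.pred) hy
  have h2' : (q : ℝ) ≤ mu0.on I := by
    rw [mu0_on_eq_countP]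
    simpa only [Nat.cast_le, Bool.and_comm] using h2
  have h3' : ((I.countP fun s => !s.bit : ℕ) : ℝ) ≤ p + t * q + mu1.on I := by
    rw [mu1_on_eq_countP]
    simp only [Bool.not_not, Bool.and_comm] at h3 ⊢
    exact_mod_cast h3
  rw [hI.iSup_profit (hP.feasible_empty hI.1)]
  refine le_trans ?_ (add_le_add_left (mul_le_mul_of_nonneg_left
    (hP.profit_eq_of_isGreedy hI hy).ge (EReal.coe_nonneg.2 α.coe_nonneg)) _)
  rw [← EReal.coe_mul, ← EReal.coe_add, EReal.coe_le_coe_iff]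
  have h1' : ((p + q : ℕ) : ℝ) = p + q := Nat.cast_add _ _
  rw [h1, h1']
  have hp : (p : ℝ) ≤ α * p := le_mul_of_one_le_left p.cast_nonneg h.one_le
  have hq : (t : ℝ) * q ≤ (α + β) * q := mul_le_mul_of_nonneg_right h.le_add q.cast_nonneg
  have hb : (β : ℝ) * q ≤ β * mu0.on I := mul_le_mul_of_nonneg_left h2' β.coe_nonneg
  have hg : (mu1.on I : ℝ) ≤ γ * mu1.on I := le_mul_of_one_le_left (NNReal.coe_nonneg _) hγ
  linarith

end IsConflictProblem

/-! ### Disjoint stars, revealed against an algorithm -/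

/-- Requests forming disjoint stars: `req c p` is the request at position `p` that belongs to the
star whose center is at position `c`; for `p = c` it is the center and otherwise a leaf. -/
structure IsStarFamily {R : Type u} (t : ℕ) (valid : ℕ → R → Prop) (conf : ℕ → R → R → Prop)
    (req : ℕ → ℕ → R) : Prop where
  valid_req : ∀ c p, c ≤ p → valid p (req c p)
  conf_iff : ∀ c p c' p', p < p' → c ≤ p → p ≤ c + t → c' ≤ p' → p' ≤ c' + t →
    (c' = p → c = p) → (conf p (req c p) (req c' p') ↔ c' = p)

section Stars

variable {R : Type u}

/-- The items of one star with center at position `c`: a center with prediction `b`, followed by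
`t` leaves if the center has been accepted. -/
def starItems (req : ℕ → ℕ → R) (t : ℕ) (b : Bool) (c : ℕ) : Bool → List (Item R)
  | true => [⟨req c c, false, b⟩]
  | false => ⟨req c c, true, b⟩ :: (List.range t).map fun j => ⟨req c (c + 1 + j), false, false⟩

/-- The input of `m` stars, the answers to the centers being given by `D`. -/
def stars (req : ℕ → ℕ → R) (t : ℕ) (b : Bool) (D : List (R × Bool) → Bool) : ℕ → List (Item R)
  | 0 => []
  | m + 1 => stars req t b D m ++ starItems req t b (stars req t b D m).length
      (D ((stars req t b D m).map (fun s => (s.request, s.pred)) ++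
        [(req (stars req t b D m).length (stars req t b D m).length, b)]))

/-- The structure of an input made of stars: `ctr i` is the position of the center of the star of
position `i`, and `bit i` is the true bit at position `i`. -/
structure IsStarInput (req : ℕ → ℕ → R) (t : ℕ) (D : List (R × Bool) → Bool) (I : List (Item R))
    (ctr : ℕ → ℕ) (bit : ℕ → Bool) : Prop where
  request_eq : ∀ i (h : i < I.length), I[i].request = req (ctr i) i
  bit_eq : ∀ i (h : i < I.length), I[i].bit = bit i
  ctr_le : ∀ i < I.length, ctr i ≤ i
  le_ctr_add : ∀ i < I.length, i ≤ ctr i + t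
  ctr_ctr : ∀ i < I.length, ctr (ctr i) = ctr i
  bit_ctr : ∀ i < I.length, ctr i < i → bit (ctr i) = true
  bit_leaf : ∀ i < I.length, ctr i < i → bit i = false
  next : ∀ i < I.length, bit i = true → i + 1 < I.length ∧ ctr (i + 1) = i
  bit_decision : ∀ i < I.length, ctr i = i →
    bit i = !D ((I.take (i + 1)).map fun s => (s.request, s.pred))

/-- All new positions get the center `I.length`. Its bit is `1` exactly if it is accepted, and then
`0 < t` provides the leaf at the following position that `next` demands. -/
theorem IsStarInput.append_star {req : ℕ → ℕ → R} {t : ℕ} (ht : 0 < t)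
    {D : List (R × Bool) → Bool} {I : List (Item R)} {ctr : ℕ → ℕ} {bit : ℕ → Bool}
    (h : IsStarInput req t D I ctr bit) (b d : Bool)
    (hd : D (I.map (fun s => (s.request, s.pred)) ++ [(req I.length I.length, b)]) = d) :
    IsStarInput req t D (I ++ starItems req t b I.length d)
      (fun i => if i < I.length then ctr i else I.length)
      (fun i => if i < I.length then bit i else decide (i = I.length) && !d) := by
  set n := I.length with hn
  have hlen : (I ++ starItems req t b n d).length = n + 1 + if d then 0 else t := by
    cases d <;> simp [starItems, hn]; omega
  have hnew : ∀ i (h1 : ¬ i < n) (h2 : i < (I ++ starItems req t b n d).length),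
      (I ++ starItems req t b n d)[i].request = req n i ∧
      (I ++ starItems req t b n d)[i].bit = (decide (i = n) && !d) := by
    intro i h1 h2
    obtain ⟨k, rfl⟩ := Nat.exists_eq_add_of_le (Nat.le_of_not_lt h1)
    rw [List.getElem_append_right (by omega)]
    rw [hlen] at h2
    simp only [← hn, Nat.add_sub_cancel_left]
    cases d
    · cases k with
      | zero => simp [starItems]
      | succ k => simp [starItems, Nat.add_assoc, Nat.add_comm 1 k]
    · have : k = 0 := by simp at h2; omega
      subst this
      simp [starItems]
  refine ⟨?_, ?_, ?_, ?_, ?_, ?_, ?_, ?_, ?_⟩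
  · intro i hi
    by_cases h1 : i < n
    · rw [List.getElem_append_left h1, h.request_eq i h1, if_pos h1]
    · rw [(hnew i h1 hi).1, if_neg h1]
  · intro i hi
    by_cases h1 : i < n
    · rw [List.getElem_append_left h1, h.bit_eq i h1, if_pos h1]
    · rw [(hnew i h1 hi).2, if_neg h1]
  · intro i hi
    have := h.ctr_le i
    grind
  · intro i hi
    have := h.le_ctr_add i
    grind
  · intro i hi
    have := h.ctr_le i
    have := h.ctr_ctr i
    grind
  · intro i hi
    have := h.ctr_le i
    have := h.bit_ctr i
    grind
  · intro i hi
    have := h.bit_leaf i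
    grind
  · intro i hi
    have := h.next i
    grind
  · intro i hi
    by_cases h1 : i < n
    · simp only [if_pos h1]
      rw [List.take_append_of_le_length (by omega)]
      exact h.bit_decision i h1
    · simp only [if_neg h1]
      rintro rfl
      have : (I ++ starItems req t b n d).take (n + 1) = I ++ [⟨req n n, !d, b⟩] := by
        rw [hn, List.take_length_add_append]
        cases d <;> simp [starItems]
      rw [this]
      simp [hd]

theorem exists_isStarInput_stars (req : ℕ → ℕ → R) {t : ℕ} (ht : 0 < t) (b : Bool)
    (D : List (R × Bool) → Bool) (m : ℕ) :
    ∃ ctr bit, IsStarInput req t D (stars req t b D m) ctr bit := by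
  induction m with
  | zero => exact ⟨id, fun _ => false, by constructor <;> simp [stars]⟩
  | succ m ih =>
    obtain ⟨ctr, bit, h⟩ := ih
    exact ⟨_, _, h.append_star ht b _ rfl⟩

/-- The number `r` counts the rejected centers. An accepted center has bit `1` and contributes `t`
zeros, its leaves. Leaves are always predicted correctly, so errors occur only at centers. -/
theorem stars_counts (req : ℕ → ℕ → R) (t : ℕ) (b : Bool) (D : List (R × Bool) → Bool) (m : ℕ) :
    ∃ r : ℕ, (stars req t b D m).countP (fun s => s.bit) + r = m ∧
      (stars req t b D m).countP (fun s => !s.bit) =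
        r + t * (stars req t b D m).countP (fun s => s.bit) ∧
      (stars req t b D m).countP (fun s => s.bit && !s.pred) =
        (if b then 0 else (stars req t b D m).countP (fun s => s.bit)) ∧
      (stars req t b D m).countP (fun s => !s.bit && s.pred) = if b then r else 0 := by
  induction m with
  | zero => exact ⟨0, by simp [stars]⟩
  | succ m ih =>
    obtain ⟨r, h1, h2, h3, h4⟩ := ih
    simp only [stars, List.countP_append, h2, h3, h4]
    cases D ((stars req t b D m).map (fun s => (s.request, s.pred)) ++
        [(req (stars req t b D m).length (stars req t b D m).length, b)])
    · refine ⟨r, ?_⟩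
      cases b <;> simp [starItems, List.countP_map, Function.comp_def] <;> grind
    · refine ⟨r + 1, ?_⟩
      cases b <;> simp [starItems] <;> grind

variable {t : ℕ} {valid : ℕ → R → Prop} {conf : ℕ → R → R → Prop} {req : ℕ → ℕ → R}
  {D : List (R × Bool) → Bool} {I : List (Item R)} {ctr : ℕ → ℕ} {bit : ℕ → Bool}

namespace IsStarInput

theorem conf_iff (h : IsStarInput req t D I ctr bit) (hreq : IsStarFamily t valid conf req)
    {i j : Fin I.length} (hij : i < j) :
    conf i I[i].request I[j].request ↔ ctr j = i := by
  have hi := i.2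
  have hj := j.2
  simp only [Fin.getElem_fin]
  rw [h.request_eq i hi, h.request_eq j hj]
  refine hreq.conf_iff _ _ _ _ hij (h.ctr_le i hi) (h.le_ctr_add i hi) (h.ctr_le j hj)
    (h.le_ctr_add j hj) fun he => ?_
  have := h.ctr_ctr j hj
  rwa [he] at this

theorem conflictAt_iff (h : IsStarInput req t D I ctr bit) (hreq : IsStarFamily t valid conf req)
    {i j : Fin I.length} : ConflictAt conf I i j ↔
      (i < j ∧ ctr j = i) ∨ (j < i ∧ ctr i = j) := by
  refine or_congr (and_congr_right fun hij => ?_) (and_congr_right fun hij => ?_)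
  · exact h.conf_iff hreq hij
  · exact h.conf_iff hreq hij

/-- A leaf is in conflict only with its center, and a center only with the at most `t` positions
following it. -/
theorem ncard_conflictAt_le (h : IsStarInput req t D I ctr bit)
    (hreq : IsStarFamily t valid conf req) (ht : 0 < t) (i : Fin I.length) :
    {j | ConflictAt conf I i j}.ncard ≤ t := by
  have hle := h.ctr_le i i.2
  rcases hle.lt_or_eq with hlt | heq
  · refine le_trans ((Set.ncard_le_one (Set.toFinite _)).2 ?_) ht
    intro a ha a' ha'
    simp only [Set.mem_ofPred_eq, h.conflictAt_iff hreq] at ha ha'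
    have key : ∀ a : Fin I.length, (i < a ∧ ctr a = i) ∨ (a < i ∧ ctr i = a) → ctr i = a := by
      rintro a (⟨-, ha⟩ | ⟨-, ha⟩)
      · have := h.ctr_ctr a a.2
        rw [ha] at this
        omega
      · exact ha
    exact Fin.ext ((key a ha).symm.trans (key a' ha'))
  · have hmaps : ∀ j ∈ {j | ConflictAt conf I i j},
        (j : ℕ) ∈ (Finset.Ioc (i : ℕ) (i + t) : Set ℕ) := by
      intro j hj
      simp only [Set.mem_ofPred_eq, h.conflictAt_iff hreq] at hj
      have := h.le_ctr_add j j.2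
      rw [Finset.coe_Ioc, Set.mem_Ioc]
      rcases hj with ⟨h1, h2⟩ | ⟨h1, h2⟩ <;> omega
    have := Set.ncard_le_ncard_of_injOn (fun j : Fin I.length => (j : ℕ)) hmaps
      (fun _ _ _ _ h => Fin.ext h) (Finset.finite_toSet _)
    rw [Set.ncard_coe_finset] at this
    simpa using this

/-- In a star input, a conflict-free set is no larger than the set of positions with bit `0`. -/
theorem card_le_of_conflictFree (h : IsStarInput req t D I ctr bit)
    (hreq : IsStarFamily t valid conf req) (S : Finset (Fin I.length))
    (hS : ∀ i ∈ S, ∀ j ∈ S, ¬ ConflictAt conf I i j) :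
    S.card ≤ (Finset.univ.filter fun i => trueBits I i = false).card := by
  have hbit : ∀ i, trueBits I i = bit i := fun i => h.bit_eq i i.2
  -- Exchange argument: each center with bit `1` is replaced by its first leaf, which is in conflict
  -- with it and hence not in `S`; this makes `f` injective on `S`.
  let f : Fin I.length → Fin I.length := fun i =>
    if hb : bit i = true then ⟨i + 1, (h.next i i.2 hb).1⟩ else i
  have hf1 : ∀ i : Fin I.length, bit i = true → (f i : ℕ) = i + 1 := fun i hb => by simp [f, hb]
  have hf0 : ∀ i : Fin I.length, ¬ bit i = true → f i = i := fun i hb => by simp [f, hb]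
  have hout : ∀ i ∈ S, bit i = true → f i ∉ S := by
    intro i hi hb hfi
    refine hS i hi _ hfi ((h.conflictAt_iff hreq).2 (Or.inl ⟨?_, ?_⟩))
    · rw [Fin.lt_def, hf1 i hb]; omega
    · rw [hf1 i hb]; exact (h.next i i.2 hb).2
  refine Finset.card_le_card_of_injOn f (fun i hi => ?_) fun i hi j hj hij => ?_
  · simp only [Finset.coe_filter, Finset.mem_univ, true_and, Set.mem_ofPred_eq, hbit]
    by_cases hb : bit i = true
    · have h1 := (h.next i i.2 hb).2
      have h2 := h.bit_leaf (i + 1) (h.next i i.2 hb).1 (by omega)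
      rw [hf1 i hb, h2]
    · rw [hf0 i hb]; simpa using hb
  · by_cases hbi : bit i = true <;> by_cases hbj : bit j = true
    · have h1 := hf1 i hbi
      have h2 := hf1 j hbj
      rw [hij] at h1
      exact Fin.ext (by omega)
    · exact absurd hj (by have := hout i hi hbi; rwa [hij, hf0 j hbj] at this)
    · exact absurd hi (by have := hout j hj hbj; rwa [← hij, hf0 i hbi] at this)
    · rw [← hf0 i hbi, hij, hf0 j hbj]

theorem isSelectionInstance (h : IsStarInput req t D I ctr bit)
    (hreq : IsStarFamily t valid conf req) (ht : 0 < t) {admissible : List (Item R) → Prop}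
    {feasible : (I : List (Item R)) → Set (Fin I.length) → Prop}
    (hP : IsConflictProblem t valid conf admissible feasible) :
    IsSelectionInstance admissible feasible I := by
  have hv : ∀ i : Fin I.length, valid i I[i].request := by
    intro i
    simp only [Fin.getElem_fin]
    rw [h.request_eq i i.2]
    exact hreq.valid_req _ _ (h.ctr_le i i.2)
  have hbit : ∀ i, trueBits I i = bit i := fun i => h.bit_eq i i.2
  refine ⟨(hP.admissible_iff I).2 ⟨hv, h.ncard_conflictAt_le hreq ht⟩, fun y => ?_⟩
  have hx : feasible I {i | trueBits I i = false} := by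
    rw [hP.feasible_iff I hv]
    intro i hi j hj hc
    simp only [Set.mem_ofPred_eq, hbit] at hi hj
    rcases (h.conflictAt_iff hreq).1 hc with ⟨h1, h2⟩ | ⟨h1, h2⟩
    · have := h.bit_ctr j j.2 (by omega)
      rw [h2, hi] at this
      cases this
    · have := h.bit_ctr i i.2 (by omega)
      rw [h2, hj] at this
      cases this
  by_cases hy : feasible I {i | y i = false}
  · rw [profit_of_feasible hy, profit_of_feasible hx, EReal.coe_le_coe_iff, Nat.cast_le]
    rw [hP.feasible_iff I hv] at hy
    exact h.card_le_of_conflictFree hreq _ (by simpa using hy)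
  · rw [profit_of_not_feasible hy]
    exact bot_le

/-- Against its own star input an algorithm that stays feasible accepts only centers of stars
with leaves. -/
theorem card_guesses_le (h : IsStarInput req t D I ctr bit)
    (hreq : IsStarFamily t valid conf req)
    (hS : ∀ i ∈ {i | guesses D I i = false}, ∀ j ∈ {i | guesses D I i = false},
      ¬ ConflictAt conf I i j) :
    (Finset.univ.filter fun i => guesses D I i = false).card ≤ I.countP fun s => s.bit := by
  rw [← card_filter_getElem]
  refine Finset.card_le_card fun i => ?_
  simp only [Finset.mem_filter, Finset.mem_univ, true_and, Fin.getElem_fin]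
  intro hi
  rw [h.bit_eq i i.2]
  have hdec : ∀ i : Fin I.length, ctr i = i → bit i = !guesses D I i :=
    fun i hc => h.bit_decision i i.2 hc
  rcases (h.ctr_le i i.2).lt_or_eq with hlt | heq
  · have hc : ctr i < I.length := hlt.trans i.2
    have h1 := h.bit_ctr i i.2 hlt
    have h2 := hdec ⟨ctr i, hc⟩ (h.ctr_ctr i i.2)
    refine absurd ((h.conflictAt_iff hreq).2 (Or.inl ⟨hlt, rfl⟩)) (hS ⟨ctr i, hc⟩ ?_ i hi)
    simp only at h2
    rw [h1] at h2
    simpa using h2.symm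
  · rw [hdec i heq, hi]
    rfl

end IsStarInput

end Stars

/-! ### Lower bounds from star inputs -/

namespace IsConflictProblem

variable {R : Type u} {t : ℕ} {valid : ℕ → R → Prop} {conf : ℕ → R → R → Prop}
  {admissible : List (Item R) → Prop} {feasible : (I : List (Item R)) → Set (Fin I.length) → Prop}

theorem achievable (hP : IsConflictProblem t valid conf admissible feasible)
    {req : ℕ → ℕ → R} (hreq : IsStarFamily t valid conf req) (ht : 0 < t) {α β γ : ℝ≥0}
    (h : (selectionProblem R admissible feasible).HasCompetitive mu0 mu1 α β γ) :
    Achievable t α β γ := by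
  obtain ⟨A, hA⟩ := h
  obtain ⟨κ, h⟩ := (selectionProblem_isCompetitive_iff _ _ _ _).1 hA
  change List (R × Bool) → Bool at A
  have h' : ∀ b D m, ((((stars req t b D m).countP fun s => !s.bit : ℕ) : ℝ) : EReal) ≤
      ((α : ℝ) : EReal) * profit feasible _ (guesses A (stars req t b D m)) +
      ((β * ((stars req t b D m).countP fun s => s.bit && !s.pred : ℕ) +
        γ * ((stars req t b D m).countP fun s => !s.bit && s.pred : ℕ) + κ : ℝ) : EReal) := by
    intro b D m
    obtain ⟨ctr, bit, hs⟩ := exists_isStarInput_stars req ht b D m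
    have hI := hs.isSelectionInstance hreq ht hP
    have := h _ hI
    rwa [hI.iSup_profit (hP.feasible_empty hI.1), mu0_on_eq_countP, mu1_on_eq_countP] at this
  -- Stars built for the algorithm that rejects everything are `m` isolated centers, all correctly
  -- predicted `0`. The profit of `A` on them is bounded by the optimum `m`, which needs no
  -- feasibility.
  have hα1 : (1 : ℝ) ≤ α := by
    refine one_le_of_forall_le_mul_add (κ := κ) fun m => ?_
    obtain ⟨r, h1, h2, h3, h4⟩ := stars_counts req t false (fun _ => true) m
    have h0 : (stars req t false (fun _ => true) m).countP (fun s => s.bit) = 0 := by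
      refine List.countP_eq_zero.2 ?_
      clear h1 h2 h3 h4
      induction m with
      | zero => simp [stars]
      | succ m ih =>
        simp only [stars, starItems, List.mem_append, List.mem_singleton]
        rintro s (hs | rfl)
        · exact ih s hs
        · simp
    have := h' false (fun _ => true) m
    obtain ⟨ctr, bit, hs⟩ := exists_isStarInput_stars req ht false (fun _ => true) m
    have hI := hs.isSelectionInstance hreq ht hP
    have hle := le_iSup (profit feasible _) (guesses A (stars req t false (fun _ => true) m))
    rw [hI.iSup_profit (hP.feasible_empty hI.1)] at hle
    replace this := this.trans (add_le_add_left
      (mul_le_mul_of_nonneg_left hle (EReal.coe_nonneg.2 α.coe_nonneg)) _)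
    rw [← EReal.coe_mul, ← EReal.coe_add, EReal.coe_le_coe_iff, h2, h3, h4, h0] at this
    have hr : r = m := by omega
    simpa [hr] using this
  have hmain : ∀ b m, (((stars req t b A m).countP fun s => !s.bit : ℕ) : ℝ) ≤
      α * ((stars req t b A m).countP fun s => s.bit : ℕ) +
      (β * ((stars req t b A m).countP fun s => s.bit && !s.pred : ℕ) +
        γ * ((stars req t b A m).countP fun s => !s.bit && s.pred : ℕ) + κ) := by
    intro b m
    obtain ⟨ctr, bit, hs⟩ := exists_isStarInput_stars req ht b A m
    have hI := hs.isSelectionInstance hreq ht hP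
    have := h' b A m
    by_cases hf : feasible _ {i | guesses A (stars req t b A m) i = false}
    · rw [profit_of_feasible hf, ← EReal.coe_mul, ← EReal.coe_add, EReal.coe_le_coe_iff] at this
      refine this.trans (add_le_add_left (mul_le_mul_of_nonneg_left ?_ α.coe_nonneg) _)
      rw [hP.feasible_iff _ ((hP.admissible_iff _).1 hI.1).1] at hf
      exact_mod_cast hs.card_guesses_le hreq hf
    -- Here `1 ≤ α` is essential: it gives `α * ⊥ = ⊥`, so an infeasible answer violates the bound,
    -- whereas `0 * ⊥ = 0`.
    · rw [profit_of_not_feasible hf, EReal.coe_mul_bot_of_pos (by linarith), EReal.bot_add,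
        le_bot_iff] at this
      exact absurd this (EReal.coe_ne_bot _)
  refine ⟨hα1, ?_, ?_⟩
  · refine (le_or_one_le_of_forall_rounds (G := 0) (κ := κ) fun m => ?_).resolve_right (by norm_num)
    obtain ⟨r, h1, h2, h3, h4⟩ := stars_counts req t false A m
    refine ⟨_, _, h1, ?_⟩
    have := hmain false m
    rw [h2, h3, h4] at this
    simp only [Bool.false_eq_true, if_false] at this
    push_cast at this
    linarith
  · refine le_or_one_le_of_forall_rounds (κ := κ) fun m => ?_
    obtain ⟨r, h1, h2, h3, h4⟩ := stars_counts req t true A m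
    refine ⟨_, _, h1, ?_⟩
    have := hmain true m
    rw [h2, h3, h4] at this
    simp only [if_true] at this
    push_cast at this
    linarith

end IsConflictProblem

/-! ## Completeness -/

/-- Each direction passes through `Achievable`, discarding optimality of the given algorithm. In the
purely online case `β = 0` turns `t ≤ α + β` into `t ≤ c`. -/
theorem IsConflictProblem.isComplete {R : Type u} {t : ℕ} {valid : ℕ → R → Prop}
    {conf : ℕ → R → R → Prop} {admissible : List (Item R) → Prop}
    {feasible : (I : List (Item R)) → Set (Fin I.length) → Prop}
    (hP : IsConflictProblem t valid conf admissible feasible)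
    {req : ℕ → ℕ → R} (hreq : IsStarFamily t valid conf req) (ht : 0 < t) :
    (selectionProblem R admissible feasible).IsComplete t mu0 mu1 ∧
      (selectionProblem R admissible feasible).IsPureComplete t := by
  refine ⟨⟨?_, ?_⟩, ?_, ?_⟩
  · rintro α β γ ⟨A, hA, -⟩
    exact hP.hasCompetitive ht (ASG.achievable ht ⟨A, hA⟩)
  · rintro α β γ ⟨A, hA, -⟩
    exact ASG.hasCompetitive ht (hP.achievable hreq ht ⟨A, hA⟩)
  · rintro c ⟨A, hA, -⟩
    exact hP.exists_isPureCompetitive ht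
      (by simpa using (ASG.achievable ht (hA.hasCompetitive mu0 mu1)).le_add)
  · rintro c ⟨A, hA, -⟩
    exact ASG.exists_isPureCompetitive ht
      (by simpa using (hP.achievable hreq ht (hA.hasCompetitive mu0 mu1)).le_add)

/-! ### Interval scheduling and set packing -/

theorem conflictAt_iff_of_symm {R : Type u} {rel : R → R → Prop}
    (hrel : ∀ r r', rel r r' → rel r' r) {I : List (Item R)} {i j : Fin I.length} :
    ConflictAt (fun _ => rel) I i j ↔ j ≠ i ∧ rel I[i].request I[j].request := by
  constructor
  · rintro (⟨h, hc⟩ | ⟨h, hc⟩)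
    · exact ⟨h.ne', hc⟩
    · exact ⟨h.ne, hrel _ _ hc⟩
  · rintro ⟨h, hc⟩
    rcases lt_or_gt_of_ne h with h | h
    · exact Or.inr ⟨h, hrel _ _ hc⟩
    · exact Or.inl ⟨h, hc⟩

theorem isConflictProblem_of_symm {R : Type u} (t : ℕ) {rel : R → R → Prop}
    (hrel : ∀ r r', rel r r' → rel r' r) :
    IsConflictProblem t (fun _ _ => True) (fun _ => rel)
      (fun I => ∀ i : Fin I.length, {j | j ≠ i ∧ rel I[i].request I[j].request}.ncard ≤ t)
      (fun I S => ∀ i ∈ S, ∀ j ∈ S, i ≠ j → ¬ rel I[i].request I[j].request) where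
  admissible_iff I := by
    simp only [conflictAt_iff_of_symm hrel, implies_true, true_and]
  feasible_iff I _ S := by
    simp only [conflictAt_iff_of_symm hrel, not_and, ne_comm]

theorem Sch.isConflictProblem (t : ℕ) : IsConflictProblem (R := RealInterval) t (fun _ _ => True)
    (fun _ r r' => (r.1 ∩ r'.1).Nonempty)
    (fun I => ∀ i : Fin I.length,
      {j : Fin I.length | j ≠ i ∧ (I[i].request.1 ∩ I[j].request.1).Nonempty}.ncard ≤ t)
    (fun I S => ∀ i ∈ S, ∀ j ∈ S, i ≠ j → ¬ (I[i].request.1 ∩ I[j].request.1).Nonempty) :=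
  isConflictProblem_of_symm t (rel := fun r r' : RealInterval => (r.1 ∩ r'.1).Nonempty)
    fun _ _ h => by rwa [Set.inter_comm]

/-- Unit intervals as centers, with distinct points of them as leaves. -/
noncomputable def Sch.starRequest (c p : ℕ) : RealInterval :=
  -- Half-open intervals keep consecutive centers disjoint; the leaf points below strictly decrease
  -- in `p` and stay inside `(c, c + 1)`.
  if p ≤ c then ⟨Set.Ico c (c + 1), ⟨c, by simp⟩, Set.ordConnected_Ico⟩
  else ⟨{(c : ℝ) + 1 / (p - c + 1)}, Set.singleton_nonempty _, Set.ordConnected_singleton⟩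

theorem Sch.point_mem {c p : ℕ} (h : c < p) :
    (c : ℝ) + 1 / (p - c + 1) ∈ Set.Ico (c : ℝ) (c + 1) := by
  have h' : (c : ℝ) < p := by exact_mod_cast h
  have h1 : 0 < 1 / ((p : ℝ) - c + 1) := by
    apply one_div_pos.2
    linarith
  have h2 : 1 / ((p : ℝ) - c + 1) < 1 := by
    rw [div_lt_one (by linarith)]
    linarith
  constructor <;> linarith

theorem Sch.starRequest_subset (c p : ℕ) :
    (starRequest c p).1 ⊆ Set.Ico (c : ℝ) (c + 1) := by
  unfold starRequest
  split_ifs with h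
  · exact subset_rfl
  · exact Set.singleton_subset_iff.2 (point_mem (not_le.1 h))

theorem Sch.isStarFamily (t : ℕ) : IsStarFamily (R := RealInterval) t (fun _ _ => True)
    (fun _ r r' => (r.1 ∩ r'.1).Nonempty) starRequest where
  valid_req _ _ _ := trivial
  conf_iff c p c' p' hpp hcp _ hcp' _ hcc := by
    constructor
    · rintro ⟨x, hx, hx'⟩
      have h1 := starRequest_subset c p hx
      have h2 := starRequest_subset c' p' hx'
      -- Requests that meet lie in the same unit interval, hence in the same star.
      have h3 : c = c' := by
        have e1 : (c : ℝ) < c' + 1 := h1.1.trans_lt h2.2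
        have e2 : (c' : ℝ) < c + 1 := h2.1.trans_lt h1.2
        norm_cast at e1 e2
        omega
      subst h3
      rcases hcp.lt_or_eq with hlt | rfl
      · exfalso
        rw [starRequest, if_neg (by omega)] at hx hx'
        simp only [Set.mem_singleton_iff] at hx hx'
        rw [hx] at hx'
        have e1 : (c : ℝ) < p := by exact_mod_cast hlt
        have e2 : (p : ℝ) < p' := by exact_mod_cast hpp
        have := one_div_lt_one_div_of_lt (show (0 : ℝ) < p - c + 1 by linarith)
          (show (p : ℝ) - c + 1 < p' - c + 1 by linarith)
        linarith
      · rfl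
    · intro h
      have := hcc h
      subst h this
      refine ⟨c + 1 / ((p' : ℝ) - c + 1), ?_, ?_⟩
      · rw [starRequest, if_pos le_rfl]
        exact point_mem hpp
      · rw [starRequest, if_neg (by omega)]
        rfl

theorem SP.isConflictProblem (U : Type u) (t : ℕ) : IsConflictProblem (R := Finset U) t
    (fun _ _ => True) (fun _ r r' => ¬ Disjoint r r')
    (fun I => ∀ i : Fin I.length,
      {j : Fin I.length | j ≠ i ∧ ¬ Disjoint I[i].request I[j].request}.ncard ≤ t)
    (fun I S => S.PairwiseDisjoint fun i => I[i].request) := by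
  have h := isConflictProblem_of_symm t (rel := fun r r' : Finset U => ¬ Disjoint r r')
    fun _ _ h h' => h h'.symm
  refine ⟨h.admissible_iff, fun I hI S => Iff.trans ?_ (h.feasible_iff I hI S)⟩
  simp only [not_not]
  exact ⟨fun h i hi j hj hij => h hi hj hij, fun h i hi j hj hij => h i hi j hj hij⟩

/-- Sets of `t` elements as centers, with their singletons as leaves. -/
def SP.starRequest {U : Type u} (e : ℕ × ℕ ↪ U) (t c p : ℕ) : Finset U :=
  ({c} ×ˢ if p ≤ c then Finset.Ioc c (c + t) else {p}).map e

theorem SP.isStarFamily {U : Type u} (e : ℕ × ℕ ↪ U) (t : ℕ) : IsStarFamily (R := Finset U) t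
    (fun _ _ => True) (fun _ r r' => ¬ Disjoint r r') (starRequest e t) where
  valid_req _ _ _ := trivial
  conf_iff c p c' p' hpp hcp hpc hcp' hpc' hcc := by
    rw [starRequest, starRequest, Finset.disjoint_map, Finset.not_disjoint_iff]
    constructor
    -- The first coordinate of a common element identifies the star; the second shows that distinct
    -- leaves of one star are disjoint.
    · rintro ⟨⟨a, b⟩, h1, h2⟩
      simp only [Finset.mem_product, Finset.mem_singleton] at h1 h2
      obtain ⟨rfl, h1⟩ := h1
      obtain ⟨rfl, h2⟩ := h2
      rw [if_neg (by omega), Finset.mem_singleton] at h2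
      subst h2
      by_contra hne
      rw [if_neg (by omega), Finset.mem_singleton] at h1
      omega
    · intro h
      have := hcc h
      subst h this
      refine ⟨(c, p'), ?_, ?_⟩
      · simp only [Finset.mem_product, Finset.mem_singleton, if_pos le_rfl, Finset.mem_Ioc]
        -- A center holds just `t` elements, one for each possible leaf, so the bound `p' ≤ c' + t`
        -- is needed.
        exact ⟨trivial, hpp, hpc'⟩
      · simp only [Finset.mem_product, Finset.mem_singleton, if_neg (not_le.2 hpp)]
        trivial

/-! ### Independent sets and cliques -/

theorem IsVertexArrival.arrivalGraph_adj {I : List (Item (Finset ℕ))} (hI : IsVertexArrival I)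
    {i j : Fin I.length} : (arrivalGraph I).Adj i j ↔
      (i < j ∧ (i : ℕ) ∈ I[j].request) ∨ (j < i ∧ (j : ℕ) ∈ I[i].request) := by
  rw [arrivalGraph, SimpleGraph.fromRel_adj]
  constructor
  · rintro ⟨-, h | h⟩
    · exact Or.inr ⟨hI i _ h, h⟩
    · exact Or.inl ⟨hI j _ h, h⟩
  · rintro (⟨h, h'⟩ | ⟨h, h'⟩)
    · exact ⟨h.ne, Or.inr h'⟩
    · exact ⟨h.ne', Or.inl h'⟩

theorem SimpleGraph.degree_eq_ncard {V : Type*} (G : SimpleGraph V) (v : V)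
    [Fintype (G.neighborSet v)] : G.degree v = {w | G.Adj v w}.ncard := by
  rw [← SimpleGraph.card_neighborSet_eq_degree, ← Nat.card_eq_fintype_card, Nat.card_coe_set_eq]
  rfl

-- An edge is announced by the later vertex naming the position of the earlier one; this is why
-- conflicts depend on positions.
open Classical in
theorem BDIS.isConflictProblem (t : ℕ) : IsConflictProblem (R := Finset ℕ) t
    (fun p r => ∀ j ∈ r, j < p) (fun p _ r' => p ∈ r')
    (fun I => IsVertexArrival I ∧ (arrivalGraph I).maxDegree ≤ t)
    (fun I S => (arrivalGraph I).IsIndepSet S) := by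
  have hadj : ∀ I : List (Item (Finset ℕ)), IsVertexArrival I → ∀ i j : Fin I.length,
      ConflictAt (fun p _ r' => p ∈ r') I i j ↔ (arrivalGraph I).Adj i j :=
    fun I hI i j => hI.arrivalGraph_adj.symm
  refine ⟨fun I => and_congr_right fun hI => ?_, fun I hI S => ?_⟩
  · simp only [hadj I hI, ← SimpleGraph.degree_eq_ncard]
    exact ⟨fun h i => ((arrivalGraph I).degree_le_maxDegree i).trans h,
      fun h => (arrivalGraph I).maxDegree_le_of_forall_degree_le t h⟩
  · simp only [hadj I hI]
    refine ⟨fun h i hi j hj hij => h hi hj hij.ne hij, fun h i hi j hj _ => h i hi j hj⟩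

/-- Isolated vertices as centers, to which the leaves are attached. -/
def BDIS.starRequest (c p : ℕ) : Finset ℕ := if p ≤ c then ∅ else {c}

theorem BDIS.isStarFamily (t : ℕ) : IsStarFamily (R := Finset ℕ) t
    (fun p r => ∀ j ∈ r, j < p) (fun p _ r' => p ∈ r') starRequest where
  valid_req c p _ := by
    unfold starRequest
    split_ifs <;> simp; omega
  conf_iff c p c' p' hpp _ _ hcp' _ _ := by
    unfold starRequest
    split_ifs with h
    · simp; omega
    · simp [eq_comm]

theorem Cli.conflictAt_iff {I : List (Item (Finset ℕ))} (hI : IsVertexArrival I)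
    (i j : Fin I.length) :
    ConflictAt (fun p _ r' => p ∉ r') I i j ↔ (arrivalGraph I)ᶜ.Adj i j := by
  rw [SimpleGraph.compl_adj, hI.arrivalGraph_adj, ConflictAt]
  rcases lt_trichotomy i j with h | h | h
  · simp [h, h.ne, h.not_gt]
  · simp [h]
  · simp [h, h.ne', h.not_gt]

-- In the complement graph cliques become independent sets, and the bound on the minimum degree says
-- that all degrees are at most `t`.
open Classical in
theorem Cli.isConflictProblem (t : ℕ) : IsConflictProblem (R := Finset ℕ) t
    (fun p r => ∀ j ∈ r, j < p) (fun p _ r' => p ∉ r')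
    (fun I => IsVertexArrival I ∧
      (I.length : ℤ) - 1 - (t : ℤ) ≤ ((arrivalGraph I).minDegree : ℤ))
    (fun I S => (arrivalGraph I).IsClique S) := by
  refine ⟨fun I => and_congr_right fun hI => ?_, fun I hI S => ?_⟩
  · simp only [conflictAt_iff hI, ← SimpleGraph.degree_eq_ncard, SimpleGraph.degree_compl,
      Fintype.card_fin]
    constructor
    · intro h i
      have := (arrivalGraph I).minDegree_le_degree i
      omega
    · intro h
      -- The empty graph has no vertex attaining the minimum degree; there the left side is
      -- negative.
      rcases Nat.eq_zero_or_pos I.length with h0 | h0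
      · omega
      · have : Nonempty (Fin I.length) := ⟨⟨0, h0⟩⟩
        have := (arrivalGraph I).le_minDegree_of_forall_le_degree (I.length - 1 - t) fun i => by
          have := h i
          omega
        omega
  · simp only [conflictAt_iff hI, SimpleGraph.compl_adj, not_and, not_not]
    exact ⟨fun h i hi j hj hij => h hi hj hij, fun h i hi j hj hij => h i hi j hj hij⟩

/-- Vertices adjacent to all earlier ones as centers, to which the leaves are not adjacent. -/
def Cli.starRequest (c p : ℕ) : Finset ℕ :=
  if p ≤ c then Finset.range p else (Finset.range p).erase c

theorem Cli.isStarFamily (t : ℕ) : IsStarFamily (R := Finset ℕ) t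
    (fun p r => ∀ j ∈ r, j < p) (fun p _ r' => p ∉ r') starRequest where
  valid_req c p _ := by
    unfold starRequest
    split_ifs <;> simp
  conf_iff c p c' p' hpp _ _ hcp' _ _ := by
    unfold starRequest
    split_ifs with h
    · simp; omega
    · simp [hpp, eq_comm]

theorem mainTheorem2 (t : ℕ) (ht : 0 < t) (U : Type*) [Infinite U] :
    ((Sch t).IsComplete t mu0 mu1 ∧ (SP U t).IsComplete t mu0 mu1 ∧
      (Cli t).IsComplete t mu0 mu1 ∧ (BDIS t).IsComplete t mu0 mu1) ∧
    ((Sch t).IsPureComplete t ∧ (SP U t).IsPureComplete t ∧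
      (Cli t).IsPureComplete t ∧ (BDIS t).IsPureComplete t) := by
  have h1 := (Sch.isConflictProblem t).isComplete (Sch.isStarFamily t) ht
  have h2 := (SP.isConflictProblem U t).isComplete (SP.isStarFamily
    (Nat.pairEquiv.toEmbedding.trans (Infinite.natEmbedding U)) t) ht
  have h3 := (Cli.isConflictProblem t).isComplete (Cli.isStarFamily t) ht
  have h4 := (BDIS.isConflictProblem t).isComplete (BDIS.isStarFamily t) ht
  exact ⟨⟨h1.1, h2.1, h3.1, h4.1⟩, h1.2, h2.2, h3.2, h4.2⟩
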